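/- Let $m,k\ge 0$ be integers, let $Q\in\mathbb{R}^{m\times m}$ be symmetric and let $D\in\mathbb{R}^{k\times m}$. For $(q,b)\in\mathbb{R}^m\times\mathbb{R}^k$ consider the quadratic program \[ \mathrm{qp}_{\rm opt}(q,b)\;=\;\inf\left\{\, q^Tz+\tfrac12 z^TQz \;:\; z\in\mathbb{R}^m,\ Dz\ge b \,\right\}\in[-\infty,+\infty], \] and let $\mathrm{dom}(Q,D)=\{(q,b)\in\mathbb{R}^{m+k} : -\infty<\mathrm{qp}_{\rm opt}(q,b)<+\infty\}$. A \emph{polyhedron} is the solution set of finitely many non-strict linear inequalities (possibly empty), and a \emph{quadratic function} is the sum of a (not necessarily convex, possibly zero) quadratic form, a linear form and a constant. Suppose that $Q$ is copositive on $D_\infty=\{v\in\mathbb{R}^m : Dv\ge 0\}$, that is, $v^TQv\ge 0$ for all $v\in D_\infty$. Then: (a) $\mathrm{qp}_{\rm opt}$ is continuous on $\mathrm{dom}(Q,D)$. (b) $\mathrm{dom}(Q,D)$ is the union of finitely many polyhedra; in particular it is closed. (c) There are a finite family of polyhedra $S_F\subseteq\mathbb{R}^{m+k}$ with $\bigcup_F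 S_F=\mathrm{dom}(Q,D)$ and quadratic functions $\mathrm{qp}_F:\mathbb{R}^{m+k}\to\mathbb{R}$, one for each $F$, such that \[ \mathrm{qp}_{\rm opt}(q,b)=\min_{F\,:\,(q,b)\in S_F}\mathrm{qp}_F(q,b)\qquad\text{for all }(q,b)\in\mathrm{dom}(Q,D). \] Hence $\mathrm{qp}_{\rm opt}$ is piecewise quadratic on $\mathrm{dom}(Q,D)$: it is continuous there, and there are finitely many quadratic functions such that at each point of $\mathrm{dom}(Q,D)$ the value of $\mathrm{qp}_{\rm opt}$ is the value of one of them. (d) For each $(q,b)\in\mathrm{dom}(Q,D)$, the set of optimal solutions of the quadratic program is nonempty and is the union of finitely many polyhedra. -/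

import Mathlib

open Matrix

namespace CopositiveQP

section General

variable {E : Type*} [AddCommGroup E] [Module ℝ E]

/-- A polyhedron: the solution set of finitely many (non-strict) linear inequalities.
The empty set and the whole space are polyhedra. -/
def IsPolyhedron (S : Set E) : Prop :=
  ∃ (N : ℕ) (a : Fin N → (E →ₗ[ℝ] ℝ)) (β : Fin N → ℝ), S = {x | ∀ i, β i ≤ a i x}

/-- `S` is the union of finitely many polyhedra. -/
def IsFiniteUnionOfPolyhedra (S : Set E) : Prop :=
  ∃ (N : ℕ) (P : Fin N → Set E), (∀ i, IsPolyhedron (P i)) ∧ S = ⋃ i, P i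

/-- A (possibly nonconvex, possibly degenerate) quadratic function: the sum of a quadratic form,
a linear form and a constant. -/
def IsQuadraticFunction (f : E → ℝ) : Prop :=
  ∃ (A : QuadraticForm ℝ E) (l : E →ₗ[ℝ] ℝ) (c : ℝ), ∀ x, f x = A x + l x + c

/-- `θ` is piecewise quadratic on `S`: it is continuous on `S`, and there are finitely many
quadratic functions (at least one) such that at each point of `S` the value of `θ` is the value of
one of them. -/
def IsPiecewiseQuadraticOn [TopologicalSpace E] (θ : E → ℝ) (S : Set E) : Prop :=
  ContinuousOn θ S ∧
    ∃ (I : ℕ) (p : Fin I → E → ℝ), 0 < I ∧ (∀ i, IsQuadraticFunction (p i)) ∧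
      ∀ x ∈ S, ∃ i, θ x = p i x

end General

section Program

variable {m k : ℕ}

/-- The feasible set `{z ∈ ℝᵐ | D z ≥ b}`. -/
def feasibleSet (D : Matrix (Fin k) (Fin m) ℝ) (b : Fin k → ℝ) : Set (Fin m → ℝ) :=
  {z | b ≤ D *ᵥ z}

/-- The recession cone `{v ∈ ℝᵐ | D v ≥ 0}`. -/
def recessionCone (D : Matrix (Fin k) (Fin m) ℝ) : Set (Fin m → ℝ) :=
  {v | 0 ≤ D *ᵥ v}

/-- `Q` is copositive on the set `C`: `vᵀ Q v ≥ 0` for all `v ∈ C`. -/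
def IsCopositiveOn (Q : Matrix (Fin m) (Fin m) ℝ) (C : Set (Fin m → ℝ)) : Prop :=
  ∀ v ∈ C, 0 ≤ v ⬝ᵥ (Q *ᵥ v)

/-- The objective `qᵀ z + (1/2) zᵀ Q z`. -/
noncomputable def objective (Q : Matrix (Fin m) (Fin m) ℝ) (q z : Fin m → ℝ) : ℝ :=
  q ⬝ᵥ z + (1 / 2) * (z ⬝ᵥ (Q *ᵥ z))

/-- The optimal value of the program with data `x = (q, b)`, as an extended real number
(`+∞` if the program is infeasible, `-∞` if it is unbounded below). -/
noncomputable def qpOpt (Q : Matrix (Fin m) (Fin m) ℝ) (D : Matrix (Fin k) (Fin m) ℝ)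
    (x : (Fin m → ℝ) × (Fin k → ℝ)) : EReal :=
  ⨅ z ∈ feasibleSet D x.2, (objective Q x.1 z : EReal)

/-- The domain of finiteness of the optimal value. -/
def qpDom (Q : Matrix (Fin m) (Fin m) ℝ) (D : Matrix (Fin k) (Fin m) ℝ) :
    Set ((Fin m → ℝ) × (Fin k → ℝ)) :=
  {x | ⊥ < qpOpt Q D x ∧ qpOpt Q D x < ⊤}

/-- The optimal value as a real number; this is used only at points of `qpDom Q D`, where it is
equal to the extended real optimal value. -/
noncomputable def qpVal (Q : Matrix (Fin m) (Fin m) ℝ) (D : Matrix (Fin k) (Fin m) ℝ)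
    (x : (Fin m → ℝ) × (Fin k → ℝ)) : ℝ :=
  (qpOpt Q D x).toReal

/-- The set of (globally) optimal solutions of the program with data `x = (q, b)`. -/
def qpSol (Q : Matrix (Fin m) (Fin m) ℝ) (D : Matrix (Fin k) (Fin m) ℝ)
    (x : (Fin m → ℝ) × (Fin k → ℝ)) : Set (Fin m → ℝ) :=
  {z | z ∈ feasibleSet D x.2 ∧ IsMinOn (objective Q x.1) (feasibleSet D x.2) z}

end Program

end CopositiveQP

open CopositiveQP

namespace CopositiveQP

/-! ### Polyhedra, projections and finite unions. -/

section Polyhedra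

variable {E F : Type*} [AddCommGroup E] [Module ℝ E] [AddCommGroup F] [Module ℝ F]

/-! The argument rests on two finiteness facts. Projections of polyhedra are polyhedra
(`IsPolyhedron.exists_real`, `IsPolyhedron.exists_pi`), and there are finitely many patterns `F` of
active constraints; for each `F` the KKT conditions are linear in `(q, b, z, l)` jointly.

Solvability: if the program is feasible and `(q + Qz) ⬝ v ≥ 0` for all feasible `z` and all `v` in
the recession cone with `vᵀQv = 0`, then copositivity yields an optimal solution
(`qpSol_nonempty_of_forall`). The condition is also necessary for a finite value
(`dotProduct_nonneg_of_mem_qpDom`), so it characterizes the domain.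

Domain: the directions `v` in this condition are the optimal solutions of the program with zero
data, hence lie in finitely many finitely generated KKT cones, and testing the generators suffices
(`exists_test_directions`). For one generator, the condition bounds the minimum of a linear program
from below; that minimum is attained at a KKT point, so the condition cuts out a finite union of
polyhedra (`isFiniteUnion_nonneg_direction`).

Value: although KKT points are not unique, the objective at any KKT point with pattern `F` is one
quadratic function of `(q, b)` (`exists_quadratic_value`). The optimal value is the least of these
over the available patterns, and the solution set is the union of the KKT polyhedra whose value is
optimal. Continuity combines closedness of the pieces with stability of the feasible set
(`eventually_exists_feasible_near`). -/

theorem isPolyhedron_of_finite {ι : Type*} [Finite ι] (a : ι → (E →ₗ[ℝ] ℝ)) (β : ι → ℝ) :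
    IsPolyhedron {x | ∀ i, β i ≤ a i x} := by
  obtain ⟨N, ⟨e⟩⟩ := Finite.exists_equiv_fin ι
  refine ⟨N, fun i => a (e.symm i), fun i => β (e.symm i), ?_⟩
  ext x
  exact ⟨fun h i => h _, fun h i => by simpa using h (e i)⟩

theorem IsPolyhedron.iInter {ι : Type*} [Finite ι] {S : ι → Set E}
    (hS : ∀ i, IsPolyhedron (S i)) : IsPolyhedron (⋂ i, S i) := by
  choose N a β h using hS
  have := isPolyhedron_of_finite (ι := Σ i, Fin (N i)) (fun p => a p.1 p.2) (fun p => β p.1 p.2)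
  convert this using 1
  ext x
  simp only [Set.mem_iInter, Set.mem_ofPred_eq, Sigma.forall]
  refine forall_congr' fun i => ?_
  rw [h i]
  rfl

theorem isPolyhedron_setOf_forall {ι : Type*} [Finite ι] {p : ι → E → Prop}
    (hp : ∀ i, IsPolyhedron {x | p i x}) : IsPolyhedron {x | ∀ i, p i x} := by
  rw [Set.ofPred_forall]
  exact .iInter hp

theorem IsPolyhedron.inter {S T : Set E} (hS : IsPolyhedron S) (hT : IsPolyhedron T) :
    IsPolyhedron (S ∩ T) := by
  rw [Set.inter_eq_iInter]
  exact .iInter fun b => by cases b <;> assumption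

theorem isPolyhedron_const (p : Prop) : IsPolyhedron {_x : E | p} := by
  by_cases hp : p
  · exact ⟨0, fun _ => 0, fun _ => 0, by simp [hp]⟩
  · refine ⟨1, fun _ => 0, fun _ => 1, ?_⟩
    ext x
    simp [hp]

theorem isPolyhedron_setOf_imp {p : Prop} {r : E → Prop} (h : p → IsPolyhedron {x | r x}) :
    IsPolyhedron {x | p → r x} := by
  by_cases hp : p
  · simpa [hp] using h hp
  · simpa [hp] using isPolyhedron_const (E := E) True

theorem isPolyhedron_setOf_le {f : E → ℝ} (hf : IsLinearMap ℝ f) (c : ℝ) :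
    IsPolyhedron {x | c ≤ f x} :=
  ⟨1, fun _ => hf.mk', fun _ => c, by simp⟩

theorem isPolyhedron_setOf_eq {f : E → ℝ} (hf : IsLinearMap ℝ f) (c : ℝ) :
    IsPolyhedron {x | f x = c} := by
  convert (isPolyhedron_setOf_le hf c).inter
    (isPolyhedron_setOf_le (-hf.mk').isLinear (-c)) using 1
  ext x
  simp [le_antisymm_iff, and_comm]

theorem isPolyhedron_setOf_vec_eq {n : ℕ} {f : E → Fin n → ℝ} (hf : IsLinearMap ℝ f)
    (c : Fin n → ℝ) : IsPolyhedron {x | f x = c} := by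
  simp only [funext_iff]
  exact isPolyhedron_setOf_forall fun i => isPolyhedron_setOf_eq
    ⟨fun x y => by rw [hf.map_add]; rfl, fun t x => by rw [hf.map_smul]; rfl⟩ _

theorem isPolyhedron_setOf_vec_le {n : ℕ} {f : E → Fin n → ℝ} (hf : IsLinearMap ℝ f)
    (c : Fin n → ℝ) : IsPolyhedron {x | c ≤ f x} :=
  isPolyhedron_setOf_forall fun i => isPolyhedron_setOf_le
    ⟨fun x y => by rw [hf.map_add]; rfl, fun t x => by rw [hf.map_smul]; rfl⟩ _

theorem IsPolyhedron.preimage {S : Set F} (hS : IsPolyhedron S) (f : E →ₗ[ℝ] F) (c : F) :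
    IsPolyhedron {x | f x + c ∈ S} := by
  obtain ⟨N, a, β, rfl⟩ := hS
  refine ⟨N, fun i => a i ∘ₗ f, fun i => β i - a i c, ?_⟩
  ext x
  simp

theorem exists_between_of_finite {A B : Set ℝ} (hA : A.Finite) (hB : B.Finite)
    (h : ∀ a ∈ A, ∀ b ∈ B, a ≤ b) : ∃ t, (∀ a ∈ A, a ≤ t) ∧ ∀ b ∈ B, t ≤ b := by
  rcases A.eq_empty_or_nonempty with rfl | hA'
  · obtain ⟨t, ht⟩ := hB.bddBelow
    exact ⟨t, by simp, fun b hb => ht hb⟩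
  rcases B.eq_empty_or_nonempty with rfl | hB'
  · obtain ⟨t, ht⟩ := hA.bddAbove
    exact ⟨t, fun a ha => ht ha, by simp⟩
  obtain ⟨t, h1, h2⟩ := exists_between_of_forall_le hA' hB' h
  exact ⟨t, fun a ha => h1 ha, fun b hb => h2 hb⟩

/-- Elimination of one variable (Fourier–Motzkin). -/
theorem IsPolyhedron.exists_real {S : Set (E × ℝ)} (hS : IsPolyhedron S) :
    IsPolyhedron {x | ∃ t, (x, t) ∈ S} := by
  obtain ⟨N, a, β, rfl⟩ := hS
  set c : Fin N → ℝ := fun i => a i (0, 1) with hc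
  set r : Fin N → E →ₗ[ℝ] ℝ := fun i => a i ∘ₗ LinearMap.inl ℝ E ℝ with hr
  have hsplit : ∀ i x t, a i (x, t) = r i x + t * c i := by
    intro i x t
    have : ((x, t) : E × ℝ) = (x, 0) + t • (0, 1) := by simp
    rw [this, map_add, map_smul]
    simp [hr, hc]
  -- Constraint `i` bounds `t` from below if `c i > 0`, from above if `c i < 0`, and not at all if
  -- `c i = 0`. A suitable `t` exists iff the last kind hold and every lower bound is at most every
  -- upper bound.
  have h1 : IsPolyhedron {x : E | ∀ i, c i = 0 → β i ≤ r i x} :=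
    isPolyhedron_setOf_forall fun i => isPolyhedron_setOf_imp fun _ =>
      isPolyhedron_setOf_le (r i).isLinear _
  have h2 : IsPolyhedron {x : E | ∀ i j, 0 < c i → c j < 0 →
      β i * (-c j) + β j * c i ≤ ((-c j) • r i + c i • r j) x} :=
    isPolyhedron_setOf_forall fun i => isPolyhedron_setOf_forall fun j =>
      isPolyhedron_setOf_imp fun _ => isPolyhedron_setOf_imp fun _ =>
        isPolyhedron_setOf_le (LinearMap.isLinear _) _
  convert h1.inter h2 using 1
  ext x
  simp only [Set.mem_ofPred_eq, hsplit, Set.mem_inter_iff, LinearMap.add_apply,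
    LinearMap.smul_apply, smul_eq_mul]
  constructor
  · rintro ⟨t, ht⟩
    refine ⟨fun i hi => by simpa [hi] using ht i, fun i j hi hj => ?_⟩
    have e1 := mul_le_mul_of_nonneg_right (ht i) (neg_pos.2 hj).le
    have e2 := mul_le_mul_of_nonneg_right (ht j) hi.le
    linarith
  · rintro ⟨h0, hp⟩
    obtain ⟨t, ht1, ht2⟩ := exists_between_of_finite
      (A := (fun i => (β i - r i x) / c i) '' {i | 0 < c i})
      (B := (fun i => (β i - r i x) / c i) '' {i | c i < 0})
      (Set.toFinite _) (Set.toFinite _) (by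
        rintro _ ⟨i, hi, rfl⟩ _ ⟨j, hj, rfl⟩
        have hi : 0 < c i := hi
        have hj : c j < 0 := hj
        have := hp i j hi hj
        simp only
        rw [div_le_iff₀ hi, div_mul_eq_mul_div, le_div_iff_of_neg hj]
        linarith)
    refine ⟨t, fun i => ?_⟩
    rcases lt_trichotomy (c i) 0 with hi | hi | hi
    · have := ht2 _ ⟨i, hi, rfl⟩
      simp only at this
      rw [le_div_iff_of_neg hi] at this
      linarith
    · simpa [hi] using h0 i hi
    · have := ht1 _ ⟨i, hi, rfl⟩
      simp only at this
      rw [div_le_iff₀ hi] at this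
      linarith

theorem IsPolyhedron.exists_pi {n : ℕ} {S : Set (E × (Fin n → ℝ))} (hS : IsPolyhedron S) :
    IsPolyhedron {x | ∃ y, (x, y) ∈ S} := by
  induction n with
  | zero =>
    convert hS.preimage (LinearMap.inl ℝ E (Fin 0 → ℝ)) 0 using 1
    ext x
    simp only [Set.mem_ofPred_eq, add_zero, LinearMap.inl_apply]
    exact ⟨fun ⟨y, hy⟩ => by rwa [Subsingleton.elim y 0] at hy, fun h => ⟨0, h⟩⟩
  | succ n ih =>
    let g : (E × (Fin n → ℝ)) × ℝ →ₗ[ℝ] E × (Fin (n + 1) → ℝ) :=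
      { toFun := fun p => (p.1.1, Fin.cons p.2 p.1.2)
        map_add' := fun p q => Prod.ext rfl (funext (Fin.cases rfl fun _ => rfl))
        map_smul' := fun c p => Prod.ext rfl (funext (Fin.cases rfl fun _ => rfl)) }
    convert ih (hS.preimage g 0).exists_real using 1
    ext x
    simp only [add_zero, Set.mem_ofPred_eq]
    constructor
    · rintro ⟨y, hy⟩
      exact ⟨Fin.tail y, y 0, by simpa [g] using hy⟩
    · rintro ⟨y, t, h⟩
      exact ⟨_, h⟩

theorem isPolyhedron_setOf_exists {n : ℕ} {p : E → (Fin n → ℝ) → Prop}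
    (h : IsPolyhedron {x : E × (Fin n → ℝ) | p x.1 x.2}) : IsPolyhedron {x | ∃ y, p x y} :=
  h.exists_pi

theorem IsPolyhedron.isClosed [TopologicalSpace E] [IsTopologicalAddGroup E] [ContinuousSMul ℝ E]
    [T2Space E] [FiniteDimensional ℝ E] {S : Set E} (hS : IsPolyhedron S) : IsClosed S := by
  obtain ⟨N, a, β, rfl⟩ := hS
  rw [Set.ofPred_forall]
  exact isClosed_iInter fun i =>
    isClosed_le continuous_const (a i).continuous_of_finiteDimensional

/-- A polyhedron that is a cone is defined by homogeneous inequalities. -/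
theorem IsPolyhedron.exists_homogeneous {S : Set E} (hS : IsPolyhedron S) (h0 : (0 : E) ∈ S)
    (hc : ∀ x ∈ S, ∀ t : ℝ, 0 ≤ t → t • x ∈ S) :
    ∃ (N : ℕ) (a : Fin N → (E →ₗ[ℝ] ℝ)), S = {x | ∀ i, 0 ≤ a i x} := by
  obtain ⟨N, a, β, rfl⟩ := hS
  refine ⟨N, a, ?_⟩
  have hβ : ∀ i, β i ≤ 0 := fun i => by simpa using h0 i
  ext x
  refine ⟨fun hx i => ?_, fun hx i => (hβ i).trans (hx i)⟩
  by_contra! hneg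
  -- The factor is chosen so that `a i` takes the value `β i - 1` at the scaled point.
  have := hc x hx ((1 - β i) / (- a i x)) (div_nonneg (by linarith [hβ i]) (by linarith)) i
  rw [map_smul, smul_eq_mul, div_mul_eq_mul_div, le_div_iff₀ (by linarith)] at this
  nlinarith

theorem IsFiniteUnionOfPolyhedra.of_finite {ι : Type*} [Finite ι] {P : ι → Set E}
    (hP : ∀ i, IsPolyhedron (P i)) : IsFiniteUnionOfPolyhedra (⋃ i, P i) := by
  obtain ⟨N, ⟨e⟩⟩ := Finite.exists_equiv_fin ι
  exact ⟨N, fun i => P (e.symm i), fun i => hP _, (e.symm.surjective.iUnion_comp P).symm⟩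

theorem IsPolyhedron.isFiniteUnion {S : Set E} (hS : IsPolyhedron S) :
    IsFiniteUnionOfPolyhedra S :=
  ⟨1, fun _ => S, fun _ => hS, by simp [Set.iUnion_const]⟩

theorem IsFiniteUnionOfPolyhedra.inter {S T : Set E} (hS : IsFiniteUnionOfPolyhedra S)
    (hT : IsFiniteUnionOfPolyhedra T) : IsFiniteUnionOfPolyhedra (S ∩ T) := by
  obtain ⟨N, P, hP, rfl⟩ := hS
  obtain ⟨M, R, hR, rfl⟩ := hT
  convert IsFiniteUnionOfPolyhedra.of_finite (ι := Fin N × Fin M)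
    (fun p => (hP p.1).inter (hR p.2)) using 1
  ext x
  simp

theorem IsFiniteUnionOfPolyhedra.iInter {n : ℕ} {S : Fin n → Set E}
    (hS : ∀ i, IsFiniteUnionOfPolyhedra (S i)) : IsFiniteUnionOfPolyhedra (⋂ i, S i) := by
  induction n with
  | zero => simpa using (isPolyhedron_const (E := E) True).isFiniteUnion
  | succ n ih =>
    convert (hS 0).inter (ih fun i => hS i.succ) using 1
    ext x
    simp [Fin.forall_fin_succ]

theorem IsFiniteUnionOfPolyhedra.isClosed [TopologicalSpace E] [IsTopologicalAddGroup E]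
    [ContinuousSMul ℝ E] [T2Space E] [FiniteDimensional ℝ E] {S : Set E}
    (hS : IsFiniteUnionOfPolyhedra S) : IsClosed S := by
  obtain ⟨N, P, hP, rfl⟩ := hS
  exact isClosed_iUnion_of_finite fun i => (hP i).isClosed

end Polyhedra

/-! ### Polyhedral cones: Farkas' lemma and finite generation. -/

section Cones

variable {m : ℕ}

theorem linearMap_eq_dotProduct (f : (Fin m → ℝ) →ₗ[ℝ] ℝ) :
    ∃ w : Fin m → ℝ, ∀ x, f x = w ⬝ᵥ x := by
  refine ⟨fun i => f (Pi.single i 1), fun x => ?_⟩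
  rw [LinearMap.pi_apply_eq_sum_univ f x]
  simp only [dotProduct, smul_eq_mul, mul_comm]
  refine Finset.sum_congr rfl fun i _ => ?_
  congr 2
  ext j
  simp [Pi.single_apply, eq_comm]

/-- A finitely generated cone is cut out by finitely many homogeneous inequalities. -/
theorem exists_dual_description {k : ℕ} (A : Matrix (Fin k) (Fin m) ℝ) :
    ∃ (N : ℕ) (B : Matrix (Fin N) (Fin m) ℝ), ∀ c : Fin m → ℝ,
      (∃ l, 0 ≤ l ∧ c = Aᵀ *ᵥ l) ↔ 0 ≤ B *ᵥ c := by
  -- The cone is the projection of a polyhedron in the variables `(c, l)`.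
  have hS : IsPolyhedron {c : Fin m → ℝ | ∃ l : Fin k → ℝ, 0 ≤ l ∧ c = Aᵀ *ᵥ l} := by
    refine isPolyhedron_setOf_exists (.inter ?_ ?_)
    · exact isPolyhedron_setOf_vec_le (E := _ × _) ⟨fun _ _ => rfl, fun _ _ => rfl⟩ 0
    · have : IsPolyhedron {x : (Fin m → ℝ) × (Fin k → ℝ) | x.1 - Aᵀ *ᵥ x.2 = 0} :=
        isPolyhedron_setOf_vec_eq ⟨fun x y => by
          simp only [Prod.fst_add, Prod.snd_add, mulVec_add]
          abel, fun t x => by simp only [Prod.smul_fst, Prod.smul_snd, mulVec_smul, smul_sub]⟩ 0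
      simp only [sub_eq_zero] at this
      exact this
  obtain ⟨N, a, ha⟩ := hS.exists_homogeneous ⟨0, le_rfl, by simp⟩ (by
    rintro _ ⟨l, hl, rfl⟩ t ht
    exact ⟨t • l, smul_nonneg ht hl, by rw [mulVec_smul]⟩)
  choose w hw using fun i => linearMap_eq_dotProduct (a i)
  refine ⟨N, Matrix.of w, fun c => ?_⟩
  have := Set.ext_iff.1 ha c
  simp only [Set.mem_ofPred_eq, hw] at this
  rw [this]
  rfl

/-- Write the cone generated by the rows of `A` as `{c | 0 ≤ B *ᵥ c}`. It contains each row of `A`,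
so each row of `B` is an admissible `w`, and the hypothesis at these `w` says that `c` is in the
cone. -/
theorem farkas {k : ℕ} (A : Matrix (Fin k) (Fin m) ℝ) (c : Fin m → ℝ)
    (h : ∀ w, 0 ≤ A *ᵥ w → 0 ≤ c ⬝ᵥ w) : ∃ l, 0 ≤ l ∧ c = Aᵀ *ᵥ l := by
  obtain ⟨N, B, hB⟩ := exists_dual_description A
  rw [hB]
  intro j
  have h1 : 0 ≤ A *ᵥ B j := fun i => by
    have := (hB (A i)).1 ⟨Pi.single i 1, by simp, by simp; rfl⟩ j
    simpa [mulVec, dotProduct_comm] using this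
  simpa [mulVec, dotProduct_comm] using h _ h1

/-- A polyhedral cone is finitely generated. -/
theorem IsPolyhedron.exists_generators {S : Set (Fin m → ℝ)} (hS : IsPolyhedron S)
    (h0 : (0 : Fin m → ℝ) ∈ S) (hc : ∀ x ∈ S, ∀ t : ℝ, 0 ≤ t → t • x ∈ S) :
    ∃ (N : ℕ) (G : Matrix (Fin N) (Fin m) ℝ), (∀ j, G j ∈ S) ∧
      ∀ v ∈ S, ∃ l, 0 ≤ l ∧ v = Gᵀ *ᵥ l := by
  obtain ⟨k, a, ha⟩ := hS.exists_homogeneous h0 hc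
  choose w hw using fun i => linearMap_eq_dotProduct (a i)
  set A : Matrix (Fin k) (Fin m) ℝ := Matrix.of w
  have hSA : ∀ v, v ∈ S ↔ 0 ≤ A *ᵥ v := fun v => by
    rw [ha]
    simp only [Set.mem_ofPred_eq, hw]
    rfl
  -- Bipolarity: the inequalities defining the cone of the rows of `A` serve as generators of its
  -- dual `S`. Farkas' lemma applies because any `c` with `0 ≤ G *ᵥ c` is a nonnegative combination
  -- of rows of `A`, hence nonnegative on `S`.
  obtain ⟨N, G, hG⟩ := exists_dual_description A
  refine ⟨N, G, fun j => ?_, fun v hv => farkas G v fun c hc' => ?_⟩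
  · rw [hSA]
    intro i
    have := (hG (A i)).1 ⟨Pi.single i 1, by simp, by simp; rfl⟩ j
    simpa [mulVec, dotProduct_comm] using this
  · obtain ⟨l, hl, rfl⟩ := (hG c).2 hc'
    rw [dotProduct_mulVec, vecMul_transpose]
    exact dotProduct_nonneg_of_nonneg ((hSA v).1 hv) hl

end Cones

open Filter Topology

/-! ### Existence of optimal solutions. -/

section Existence

variable {m k : ℕ} {Q : Matrix (Fin m) (Fin m) ℝ} {D : Matrix (Fin k) (Fin m) ℝ}

theorem qpOpt_eq_of_mem_qpSol {x : (Fin m → ℝ) × (Fin k → ℝ)} {z : Fin m → ℝ}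
    (hz : z ∈ qpSol Q D x) : qpOpt Q D x = (objective Q x.1 z : EReal) :=
  le_antisymm (iInf₂_le z hz.1) (le_iInf₂ fun w hw => by exact_mod_cast hz.2 hw)

theorem qpVal_eq_of_mem_qpSol {x : (Fin m → ℝ) × (Fin k → ℝ)} {z : Fin m → ℝ}
    (hz : z ∈ qpSol Q D x) : qpVal Q D x = objective Q x.1 z := by
  rw [qpVal, qpOpt_eq_of_mem_qpSol hz, EReal.toReal_coe]

theorem mem_qpDom_iff {x : (Fin m → ℝ) × (Fin k → ℝ)} :
    x ∈ qpDom Q D ↔ (feasibleSet D x.2).Nonempty ∧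
      ∃ r : ℝ, ∀ z ∈ feasibleSet D x.2, r ≤ objective Q x.1 z := by
  constructor
  · rintro ⟨h1, h2⟩
    constructor
    · by_contra h
      rw [Set.not_nonempty_iff_eq_empty] at h
      simp [qpOpt, h] at h2
    · refine ⟨(qpOpt Q D x).toReal, fun z hz => ?_⟩
      rw [← EReal.coe_le_coe_iff, EReal.coe_toReal h2.ne h1.ne']
      exact iInf₂_le z hz
  · rintro ⟨⟨z, hz⟩, r, hr⟩
    refine ⟨(EReal.bot_lt_coe r).trans_le (le_iInf₂ fun w hw => ?_),
      (iInf₂_le z hz).trans_lt (EReal.coe_lt_top _)⟩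
    exact_mod_cast hr w hw

theorem mem_qpDom_of_mem_qpSol {x : (Fin m → ℝ) × (Fin k → ℝ)} {z : Fin m → ℝ}
    (hz : z ∈ qpSol Q D x) : x ∈ qpDom Q D :=
  mem_qpDom_iff.2 ⟨⟨z, hz.1⟩, _, fun _ hw => hz.2 hw⟩

theorem dotProduct_mulVec_comm {n : Type*} [Fintype n] {Q : Matrix n n ℝ} (hQ : Q.IsSymm)
    (v w : n → ℝ) :
    v ⬝ᵥ (Q *ᵥ w) = w ⬝ᵥ (Q *ᵥ v) := by
  rw [dotProduct_mulVec, ← mulVec_transpose, hQ.eq, dotProduct_comm]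

theorem objective_add_smul (hQ : Q.IsSymm) (q z v : Fin m → ℝ) (t : ℝ) :
    objective Q q (z + t • v) =
      objective Q q z + t * ((q + Q *ᵥ z) ⬝ᵥ v) + t ^ 2 / 2 * (v ⬝ᵥ (Q *ᵥ v)) := by
  simp only [objective, mulVec_add, mulVec_smul, dotProduct_add, add_dotProduct, smul_dotProduct,
    dotProduct_smul, smul_eq_mul]
  rw [dotProduct_mulVec_comm hQ z v, dotProduct_comm (Q *ᵥ z) v]
  ring

theorem continuous_objective :
    Continuous fun p : (Fin m → ℝ) × (Fin m → ℝ) => objective Q p.1 p.2 := by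
  unfold objective
  fun_prop

theorem isClosed_feasibleSet (b : Fin k → ℝ) : IsClosed (feasibleSet D b) :=
  isClosed_le continuous_const (by fun_prop)

theorem dotProduct_self_nonneg (z : Fin m → ℝ) : 0 ≤ z ⬝ᵥ z :=
  Finset.sum_nonneg fun i _ => mul_self_nonneg (z i)

theorem sq_le_dotProduct_self (z : Fin m → ℝ) (i : Fin m) : z i ^ 2 ≤ z ⬝ᵥ z := by
  rw [sq]
  exact Finset.single_le_sum (f := fun i => z i * z i) (fun j _ => mul_self_nonneg _)
    (Finset.mem_univ i)

theorem isCompact_truncation (b : Fin k → ℝ) (r : ℝ) :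
    IsCompact {z | z ∈ feasibleSet D b ∧ z ⬝ᵥ z ≤ r} := by
  refine Metric.isCompact_of_isClosed_isBounded
    ((isClosed_feasibleSet b).inter (isClosed_le
      (by fun_prop : Continuous fun z : Fin m → ℝ => z ⬝ᵥ z) continuous_const)) ?_
  refine (Metric.isBounded_closedBall (x := (0 : Fin m → ℝ)) (r := √r)).subset fun z hz => ?_
  rw [mem_closedBall_zero_iff, pi_norm_le_iff_of_nonneg (Real.sqrt_nonneg _)]
  exact fun i => Real.abs_le_sqrt ((sq_le_dotProduct_self z i).trans hz.2)

/-- On each nonempty truncation of the feasible set there is a minimizer of least norm. -/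
theorem exists_least_norm_minimizer (q : Fin m → ℝ) (b : Fin k → ℝ) (r : ℝ)
    (hne : {z | z ∈ feasibleSet D b ∧ z ⬝ᵥ z ≤ r}.Nonempty) :
    ∃ z, (z ∈ feasibleSet D b ∧ z ⬝ᵥ z ≤ r) ∧
      (∀ w ∈ feasibleSet D b, w ⬝ᵥ w ≤ r → objective Q q z ≤ objective Q q w) ∧
      ∀ w ∈ feasibleSet D b, w ⬝ᵥ w ≤ r → objective Q q w ≤ objective Q q z →
        z ⬝ᵥ z ≤ w ⬝ᵥ w := by
  have hobj : Continuous (objective Q q) :=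
    continuous_objective.comp (by fun_prop : Continuous fun z => (q, z))
  obtain ⟨z₀, hz₀, hmin⟩ := (isCompact_truncation b r).exists_isMinOn hne hobj.continuousOn
  obtain ⟨z, hz, hz'⟩ := ((isCompact_truncation (D := D) b r).inter_right
    (isClosed_le hobj (continuous_const (y := objective Q q z₀)))).exists_isMinOn
    ⟨z₀, hz₀, le_refl (objective Q q z₀)⟩ (f := fun z => z ⬝ᵥ z) (by fun_prop)
  exact ⟨z, hz.1, fun w hw hwr => hz.2.trans (hmin ⟨hw, hwr⟩),
    fun w hw hwr hwz => hz' ⟨⟨hw, hwr⟩, hwz.trans hz.2⟩⟩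

/-- Eaves' existence theorem. -/
theorem qpSol_nonempty_of_forall (hQ : Q.IsSymm) (hcop : IsCopositiveOn Q (recessionCone D))
    {q : Fin m → ℝ} {b : Fin k → ℝ} (hne : (feasibleSet D b).Nonempty)
    (h : ∀ v ∈ recessionCone D, v ⬝ᵥ (Q *ᵥ v) = 0 → ∀ z ∈ feasibleSet D b,
      0 ≤ (q + Q *ᵥ z) ⬝ᵥ v) : (qpSol Q D (q, b)).Nonempty := by
  obtain ⟨p, hp⟩ := hne
  have hex : ∀ n : ℕ, ∃ z, (z ∈ feasibleSet D b ∧ z ⬝ᵥ z ≤ p ⬝ᵥ p + n) ∧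
      (∀ w ∈ feasibleSet D b, w ⬝ᵥ w ≤ p ⬝ᵥ p + n → objective Q q z ≤ objective Q q w) ∧
      ∀ w ∈ feasibleSet D b, w ⬝ᵥ w ≤ p ⬝ᵥ p + n → objective Q q w ≤ objective Q q z →
        z ⬝ᵥ z ≤ w ⬝ᵥ w := fun n =>
    exists_least_norm_minimizer q b _ ⟨p, hp, by simp⟩
  choose z hz hmin hnorm using hex
  by_cases hlim : Tendsto (fun n => ‖z n‖) atTop atTop
  swap
  · obtain ⟨R, hR⟩ : ∃ R, ∃ᶠ n in atTop, ‖z n‖ ≤ R := by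
      simp only [tendsto_atTop, not_forall, not_eventually] at hlim
      obtain ⟨R, hR⟩ := hlim
      exact ⟨R, hR.mono fun n hn => (not_le.1 hn).le⟩
    obtain ⟨C, hC⟩ : ∃ C, ∀ w : Fin m → ℝ, ‖w‖ ≤ R → w ⬝ᵥ w ≤ C := by
      obtain ⟨C, hC⟩ := (isCompact_closedBall (0 : Fin m → ℝ) R).bddAbove_image
        (f := fun w => w ⬝ᵥ w) (by fun_prop)
      exact ⟨C, fun w hw => hC ⟨w, by simpa using hw, rfl⟩⟩
    -- Truncation `N` contains the ball of radius `R`, so `z N` is at least as good as every `z n`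
    -- in that ball; such `n` are arbitrarily large, so their truncations reach every feasible
    -- point.
    obtain ⟨N, hN⟩ := exists_nat_ge (C - p ⬝ᵥ p)
    refine ⟨z N, (hz N).1, fun w hw => ?_⟩
    obtain ⟨M, hM⟩ := exists_nat_ge (w ⬝ᵥ w - p ⬝ᵥ p)
    obtain ⟨n, hn, hnR⟩ := frequently_atTop.1 hR M
    have hMn : (M : ℝ) ≤ n := by exact_mod_cast hn
    exact (hmin N _ (hz n).1 (by linarith [hC _ hnR])).trans (hmin n w hw (by linarith))
  -- Now the norms tend to infinity. A limit direction `v` of the `z n` gives a contradiction: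
  -- moving slightly along `-v` keeps feasibility, does not raise the objective, and shortens `z n`.
  exfalso
  set u : ℕ → Fin m → ℝ := fun n => ‖z n‖⁻¹ • z n with hu
  have hpos : ∀ᶠ n in atTop, 0 < ‖z n‖ := hlim.eventually_gt_atTop 0
  have hu1 : ∀ᶠ n in atTop, u n ∈ Metric.sphere (0 : Fin m → ℝ) 1 := by
    filter_upwards [hpos] with n hn
    simp [hu, norm_smul, inv_mul_cancel₀ hn.ne']
  obtain ⟨v, hv1, φ, hφ, hφv⟩ :=
    (isCompact_sphere (0 : Fin m → ℝ) 1).tendsto_subseq' hu1.frequently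
  have hinv : Tendsto (fun n => ‖z (φ n)‖⁻¹) atTop (𝓝 0) :=
    (tendsto_inv_atTop_zero.comp hlim).comp hφ.tendsto_atTop
  have hposφ : ∀ᶠ n in atTop, 0 < ‖z (φ n)‖ := hφ.tendsto_atTop.eventually hpos
  have hDu : ∀ i, Tendsto (fun n => (D *ᵥ u (φ n)) i) atTop (𝓝 ((D *ᵥ v) i)) := fun i =>
    ((by fun_prop : Continuous fun w => (D *ᵥ w) i).tendsto v).comp hφv
  have hbu : ∀ i, Tendsto (fun n => ‖z (φ n)‖⁻¹ * b i) atTop (𝓝 0) := fun i => by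
    simpa using hinv.mul_const (b i)
  have hvD : v ∈ recessionCone D := fun i => by
    refine le_of_tendsto_of_tendsto' (hbu i) (hDu i) fun n => ?_
    simp only [hu, mulVec_smul, Pi.smul_apply, smul_eq_mul]
    exact mul_le_mul_of_nonneg_left ((hz _).1 i) (by positivity)
  -- Dividing `objective Q q (z n) ≤ objective Q q p` by `‖z n‖ ^ 2` leaves only the quadratic term
  -- in the limit.
  have hvQ : v ⬝ᵥ (Q *ᵥ v) = 0 := by
    refine le_antisymm ?_ (hcop v hvD)
    have h1 : Tendsto (fun n => ‖z (φ n)‖⁻¹ * (q ⬝ᵥ u (φ n)) +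
        1 / 2 * (u (φ n) ⬝ᵥ (Q *ᵥ u (φ n)))) atTop (𝓝 (0 * (q ⬝ᵥ v) + 1 / 2 * (v ⬝ᵥ (Q *ᵥ v)))) :=
      (hinv.mul (((by fun_prop : Continuous fun w => q ⬝ᵥ w).tendsto v).comp hφv)).add
        (((by fun_prop : Continuous fun w => 1 / 2 * (w ⬝ᵥ (Q *ᵥ w))).tendsto v).comp hφv)
    have h2 : Tendsto (fun n => ‖z (φ n)‖⁻¹ * ‖z (φ n)‖⁻¹ * objective Q q p) atTop
        (𝓝 (0 * 0 * objective Q q p)) := (hinv.mul hinv).mul_const _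
    have h3 := le_of_tendsto_of_tendsto' h1 h2 fun n => by
      have e := mul_le_mul_of_nonneg_left (hmin (φ n) p hp (by simp))
        (by positivity : 0 ≤ ‖z (φ n)‖⁻¹ * ‖z (φ n)‖⁻¹)
      refine le_trans (le_of_eq ?_) e
      simp only [hu, objective, mulVec_smul, dotProduct_smul, smul_dotProduct, smul_eq_mul]
      ring
    linarith
  have hvv : 0 < v ⬝ᵥ v := by
    refine lt_of_le_of_ne (dotProduct_self_nonneg v) fun h0 => ?_
    rw [dotProduct_self_eq_zero.1 h0.symm] at hv1
    simp at hv1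
  have huv : ∀ᶠ n in atTop, 0 < u (φ n) ⬝ᵥ v :=
    (((by fun_prop : Continuous fun w => w ⬝ᵥ v).tendsto v).comp hφv).eventually_const_lt hvv
  -- Constraints with `(D *ᵥ v) i = 0` are unaffected by moving along `v`; the others become slack
  -- far out, which leaves room for a step along `-v`.
  have hDi : ∀ᶠ n in atTop, ∀ i, (D *ᵥ v) i ≠ 0 → b i < (D *ᵥ z (φ n)) i := by
    rw [eventually_all]
    intro i
    by_cases hi : (D *ᵥ v) i = 0
    · simp [hi]
    filter_upwards [(hbu i).eventually_lt (hDu i) ((hvD i).lt_of_ne' hi), hposφ] with n hn hn' _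
    simp only [hu, mulVec_smul, Pi.smul_apply, smul_eq_mul] at hn
    exact lt_of_mul_lt_mul_left hn (by positivity)
  obtain ⟨n, hn1, hn2, hn3⟩ := (huv.and (hDi.and hposφ)).exists
  set w := z (φ n) with hw
  have hwv : 0 < w ⬝ᵥ v := by
    simp only [hu, smul_dotProduct, smul_eq_mul] at hn1
    exact (pos_iff_pos_of_mul_pos hn1).1 (by positivity)
  have hfeas : ∀ᶠ t in 𝓝[>] (0 : ℝ), w + (-t) • v ∈ feasibleSet D b := by
    have : ∀ᶠ t in 𝓝[>] (0 : ℝ), ∀ i, b i ≤ (D *ᵥ (w + (-t) • v)) i := by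
      rw [eventually_all]
      intro i
      by_cases hi : (D *ᵥ v) i = 0
      · refine Eventually.of_forall fun t => ?_
        simpa [mulVec_add, mulVec_neg, mulVec_smul, hi] using (hz (φ n)).1 i
      · have hc : Continuous fun t : ℝ => (D *ᵥ (w + (-t) • v)) i := by fun_prop
        have := (hc.tendsto 0).eventually_const_lt (u := b i) (by simpa using hn2 i hi)
        exact (this.filter_mono nhdsWithin_le_nhds).mono fun t ht => ht.le
    exact this
  have hsmall : ∀ᶠ t in 𝓝[>] (0 : ℝ), t * (v ⬝ᵥ v) < 2 * (w ⬝ᵥ v) := by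
    have hc : Continuous fun t : ℝ => t * (v ⬝ᵥ v) := by fun_prop
    exact ((hc.tendsto 0).eventually_lt_const (by simpa using hwv)).filter_mono nhdsWithin_le_nhds
  obtain ⟨t, ⟨ht1, ht2⟩, ht0⟩ := ((hfeas.and hsmall).and self_mem_nhdsWithin).exists
  have ht0 : 0 < t := ht0
  have hlt : (w + (-t) • v) ⬝ᵥ (w + (-t) • v) < w ⬝ᵥ w := by
    simp only [dotProduct_add, add_dotProduct, smul_dotProduct, dotProduct_smul, smul_eq_mul]
    rw [dotProduct_comm v w]
    nlinarith
  refine (hnorm (φ n) _ ht1 (hlt.le.trans (hz _).2) ?_).not_gt hlt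
  rw [objective_add_smul hQ, hvQ]
  have := mul_nonneg ht0.le (h v hvD hvQ w (hz _).1)
  linarith

/-- Along the feasible ray `z + t • v` the objective is affine with this slope, so a negative slope
would make it unbounded below. -/
theorem dotProduct_nonneg_of_mem_qpDom (hQ : Q.IsSymm) {x : (Fin m → ℝ) × (Fin k → ℝ)}
    (hx : x ∈ qpDom Q D) {v : Fin m → ℝ} (hv : v ∈ recessionCone D)
    (hvQ : v ⬝ᵥ (Q *ᵥ v) = 0) {z : Fin m → ℝ} (hz : z ∈ feasibleSet D x.2) :
    0 ≤ (x.1 + Q *ᵥ z) ⬝ᵥ v := by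
  obtain ⟨-, r, hr⟩ := mem_qpDom_iff.1 hx
  by_contra! hneg
  set s := (x.1 + Q *ᵥ z) ⬝ᵥ v
  have hray : ∀ t : ℝ, 0 ≤ t → r ≤ objective Q x.1 z + t * s := fun t ht => by
    have hmem : z + t • v ∈ feasibleSet D x.2 := fun i => by
      have h1 : 0 ≤ t * (D *ᵥ v) i := mul_nonneg ht (hv i)
      have h2 := hz i
      simp only [mulVec_add, mulVec_smul, Pi.add_apply, Pi.smul_apply, smul_eq_mul]
      linarith
    have := hr _ hmem
    rwa [objective_add_smul hQ, hvQ, mul_zero, add_zero] at this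
  have h0 := hray 0 le_rfl
  have := hray ((objective Q x.1 z - r + 1) / (-s)) (div_nonneg (by linarith) (by linarith))
  rw [div_mul_eq_mul_div, div_neg, mul_div_cancel_right₀ _ hneg.ne] at this
  linarith

theorem qpSol_nonempty (hQ : Q.IsSymm) (hcop : IsCopositiveOn Q (recessionCone D))
    {x : (Fin m → ℝ) × (Fin k → ℝ)} (hx : x ∈ qpDom Q D) : (qpSol Q D x).Nonempty :=
  qpSol_nonempty_of_forall hQ hcop (mem_qpDom_iff.1 hx).1 fun _ hv hvQ _ hz =>
    dotProduct_nonneg_of_mem_qpDom hQ hx hv hvQ hz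

end Existence

/-! ### KKT systems, their values, and stability of the feasible set. -/

section KKT

variable {m k : ℕ}

/-- The Karush–Kuhn–Tucker conditions for the program with data `x = (q, b)`, where the
constraints in `F` are active and the multipliers vanish outside `F`. -/
def IsKKT (Q : Matrix (Fin m) (Fin m) ℝ) (D : Matrix (Fin k) (Fin m) ℝ) (F : Finset (Fin k))
    (x : (Fin m → ℝ) × (Fin k → ℝ)) (z : Fin m → ℝ) (l : Fin k → ℝ) : Prop :=
  x.2 ≤ D *ᵥ z ∧ (∀ i ∈ F, (D *ᵥ z) i = x.2 i) ∧ 0 ≤ l ∧ (∀ i ∉ F, l i = 0) ∧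
    x.1 + Q *ᵥ z = Dᵀ *ᵥ l

variable {Q : Matrix (Fin m) (Fin m) ℝ} {D : Matrix (Fin k) (Fin m) ℝ} {F : Finset (Fin k)}

theorem isPolyhedron_isKKT :
    IsPolyhedron {p : (((Fin m → ℝ) × (Fin k → ℝ)) × (Fin m → ℝ)) × (Fin k → ℝ) |
      IsKKT Q D F p.1.1 p.1.2 p.2} := by
  have h1 : IsPolyhedron {p : (((Fin m → ℝ) × (Fin k → ℝ)) × (Fin m → ℝ)) × (Fin k → ℝ) |
      0 ≤ D *ᵥ p.1.2 - p.1.1.2} :=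
    isPolyhedron_setOf_vec_le ⟨fun _ _ => by
      simp only [Prod.fst_add, Prod.snd_add, mulVec_add]
      abel, fun _ _ => by
      simp only [Prod.smul_fst, Prod.smul_snd, mulVec_smul, smul_sub]⟩ 0
  have h2 : IsPolyhedron {p : (((Fin m → ℝ) × (Fin k → ℝ)) × (Fin m → ℝ)) × (Fin k → ℝ) |
      ∀ i, i ∈ F → (D *ᵥ p.1.2 - p.1.1.2) i = 0} :=
    isPolyhedron_setOf_forall fun i => isPolyhedron_setOf_imp fun _ =>
      isPolyhedron_setOf_eq ⟨fun _ _ => by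
        simp only [Prod.fst_add, Prod.snd_add, mulVec_add, Pi.sub_apply, Pi.add_apply]
        ring, fun _ _ => by
        simp only [Prod.smul_fst, Prod.smul_snd, mulVec_smul, ← smul_sub, Pi.smul_apply]⟩ 0
  have h3 : IsPolyhedron {p : (((Fin m → ℝ) × (Fin k → ℝ)) × (Fin m → ℝ)) × (Fin k → ℝ) |
      0 ≤ p.2} :=
    isPolyhedron_setOf_vec_le ⟨fun _ _ => rfl, fun _ _ => rfl⟩ 0
  have h4 : IsPolyhedron {p : (((Fin m → ℝ) × (Fin k → ℝ)) × (Fin m → ℝ)) × (Fin k → ℝ) |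
      ∀ i, i ∉ F → p.2 i = 0} :=
    isPolyhedron_setOf_forall fun i => isPolyhedron_setOf_imp fun _ =>
      isPolyhedron_setOf_eq ⟨fun _ _ => rfl, fun _ _ => rfl⟩ 0
  have h5 : IsPolyhedron {p : (((Fin m → ℝ) × (Fin k → ℝ)) × (Fin m → ℝ)) × (Fin k → ℝ) |
      p.1.1.1 + Q *ᵥ p.1.2 - Dᵀ *ᵥ p.2 = 0} :=
    isPolyhedron_setOf_vec_eq ⟨fun _ _ => by
      simp only [Prod.fst_add, Prod.snd_add, mulVec_add]
      abel, fun _ _ => by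
      simp only [Prod.smul_fst, Prod.smul_snd, mulVec_smul, smul_sub, smul_add]⟩ 0
  simp only [sub_nonneg] at h1
  simp only [Pi.sub_apply, sub_eq_zero] at h2 h5
  exact h1.inter (h2.inter (h3.inter (h4.inter h5)))

theorem isPolyhedron_exists_isKKT :
    IsPolyhedron {x : (Fin m → ℝ) × (Fin k → ℝ) | ∃ z l, IsKKT Q D F x z l} :=
  isPolyhedron_setOf_exists (p := fun x z => ∃ l, IsKKT Q D F x z l)
    (isPolyhedron_setOf_exists
      (p := fun (y : ((Fin m → ℝ) × (Fin k → ℝ)) × (Fin m → ℝ)) l => IsKKT Q D F y.1 y.2 l)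
      isPolyhedron_isKKT)

/-- For fixed data, the KKT points with a given pattern form a polyhedron. -/
theorem isPolyhedron_isKKT_point (x : (Fin m → ℝ) × (Fin k → ℝ)) :
    IsPolyhedron {z | ∃ l, IsKKT Q D F x z l} := by
  have := (isPolyhedron_setOf_exists
      (p := fun (y : ((Fin m → ℝ) × (Fin k → ℝ)) × (Fin m → ℝ)) l => IsKKT Q D F y.1 y.2 l)
      isPolyhedron_isKKT).preimage
    (LinearMap.inr ℝ ((Fin m → ℝ) × (Fin k → ℝ)) (Fin m → ℝ)) (x, 0)
  simpa using this

/-- Complementary slackness. At zero data it gives `zᵀQz = 0`, which is how KKT generators become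
test directions. -/
theorem IsKKT.dotProduct_eq {x : (Fin m → ℝ) × (Fin k → ℝ)} {z : Fin m → ℝ} {l : Fin k → ℝ}
    (h : IsKKT Q D F x z l) : (x.1 + Q *ᵥ z) ⬝ᵥ z = x.2 ⬝ᵥ l := by
  obtain ⟨-, h2, -, h4, h5⟩ := h
  rw [h5, mulVec_transpose, ← dotProduct_mulVec, dotProduct_comm]
  refine Finset.sum_congr rfl fun i _ => ?_
  by_cases hi : i ∈ F
  · rw [h2 i hi]
  · rw [h4 i hi, mul_zero, mul_zero]

theorem IsKKT.objective_eq {x : (Fin m → ℝ) × (Fin k → ℝ)} {z : Fin m → ℝ} {l : Fin k → ℝ}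
    (h : IsKKT Q D F x z l) : objective Q x.1 z = 1 / 2 * (x.1 ⬝ᵥ z + x.2 ⬝ᵥ l) := by
  rw [← h.dotProduct_eq, objective, add_dotProduct, dotProduct_comm (Q *ᵥ z)]
  ring

/-- Weak duality for linear objectives. -/
theorem IsKKT.dotProduct_le {x : (Fin m → ℝ) × (Fin k → ℝ)} {z : Fin m → ℝ} {l : Fin k → ℝ}
    (h : IsKKT Q D F x z l) {w : Fin m → ℝ} (hw : w ∈ feasibleSet D x.2) :
    (x.1 + Q *ᵥ z) ⬝ᵥ z ≤ (x.1 + Q *ᵥ z) ⬝ᵥ w := by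
  rw [h.dotProduct_eq]
  obtain ⟨-, -, h3, -, h5⟩ := h
  rw [h5, mulVec_transpose, ← dotProduct_mulVec, dotProduct_comm]
  exact dotProduct_le_dotProduct_of_nonneg_left hw h3

/-- Optimal solutions are KKT points. -/
theorem exists_isKKT_of_mem_qpSol (hQ : Q.IsSymm) {x : (Fin m → ℝ) × (Fin k → ℝ)}
    {z : Fin m → ℝ} (hz : z ∈ qpSol Q D x) : ∃ F l, IsKKT Q D F x z l := by
  classical
  set F : Finset (Fin k) := {i | (D *ᵥ z) i = x.2 i} with hF
  have hmemF : ∀ i, i ∈ F ↔ (D *ᵥ z) i = x.2 i := fun i => by simp [hF]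
  -- Zeroing the inactive rows of `D` makes Farkas' lemma produce multipliers supported on `F`. Its
  -- hypothesis is the first-order condition along directions that do not decrease the active
  -- constraints.
  set P : Matrix (Fin k) (Fin k) ℝ := diagonal fun i => if i ∈ F then 1 else 0 with hP
  obtain ⟨l, hl, hl'⟩ := farkas (P * D) (x.1 + Q *ᵥ z) (by
    intro w hw
    have hfeas : ∀ᶠ t in 𝓝[>] (0 : ℝ), z + t • w ∈ feasibleSet D x.2 := by
      have : ∀ᶠ t in 𝓝[>] (0 : ℝ), ∀ i, x.2 i ≤ (D *ᵥ (z + t • w)) i := by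
        rw [eventually_all]
        intro i
        by_cases hi : i ∈ F
        · filter_upwards [self_mem_nhdsWithin] with t ht
          have h1 : 0 ≤ (D *ᵥ w) i := by
            have := hw i
            rw [← mulVec_mulVec, hP, mulVec_diagonal] at this
            simpa [hi] using this
          have h2 := mul_nonneg (le_of_lt ht) h1
          rw [← (hmemF i).1 hi]
          simpa [mulVec_add, mulVec_smul] using h2
        · have hc : Continuous fun t : ℝ => (D *ᵥ (z + t • w)) i := by fun_prop
          have hlt : x.2 i < (D *ᵥ z) i := (hz.1 i).lt_of_ne fun h => hi ((hmemF i).2 h.symm)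
          have := (hc.tendsto 0).eventually_const_lt (u := x.2 i) (by simpa using hlt)
          exact (this.filter_mono nhdsWithin_le_nhds).mono fun t ht => ht.le
      exact this
    have hc : Continuous fun t : ℝ => (x.1 + Q *ᵥ z) ⬝ᵥ w + t / 2 * (w ⬝ᵥ (Q *ᵥ w)) := by
      fun_prop
    have hlim := (hc.tendsto 0).mono_left (nhdsWithin_le_nhds (s := Set.Ioi 0))
    rw [zero_div, zero_mul, add_zero] at hlim
    refine ge_of_tendsto hlim ?_
    filter_upwards [hfeas, self_mem_nhdsWithin] with t ht ht0
    have ht0 : 0 < t := ht0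
    have h1 : objective Q x.1 z ≤ _ := hz.2 ht
    rw [objective_add_smul hQ] at h1
    refine nonneg_of_mul_nonneg_right (a := t) ?_ ht0
    linarith)
  refine ⟨F, P *ᵥ l, hz.1, fun i hi => (hmemF i).1 hi, fun i => ?_, fun i hi => ?_, ?_⟩
  · rw [hP, mulVec_diagonal]
    exact mul_nonneg (by split_ifs <;> simp) (hl i)
  · rw [hP, mulVec_diagonal]
    simp [hi]
  · rw [hl', transpose_mul, hP, diagonal_transpose, mulVec_mulVec]

theorem exists_generalized_inverse {V : Type*} [AddCommGroup V] [Module ℝ V] (L : V →ₗ[ℝ] V) :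
    ∃ R : V →ₗ[ℝ] V, ∀ u, L (R (L u)) = L u := by
  obtain ⟨g, hg⟩ := L.rangeRestrict.exists_rightInverse_of_surjective L.range_rangeRestrict
  obtain ⟨R, hR⟩ := LinearMap.exists_extend g
  refine ⟨R, fun u => ?_⟩
  have h1 : R (L u) = g (L.rangeRestrict u) := LinearMap.congr_fun hR (L.rangeRestrict u)
  have h2 : L (g (L.rangeRestrict u)) = L u :=
    congrArg Subtype.val (LinearMap.congr_fun hg (L.rangeRestrict u))
  rw [h1, h2]

theorem isQuadraticFunction_dotProduct {E n : Type*} [AddCommGroup E] [Module ℝ E] [Fintype n]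
    (f g : E →ₗ[ℝ] (n → ℝ)) : IsQuadraticFunction fun x => f x ⬝ᵥ g x :=
  ⟨∑ i, QuadraticMap.linMulLin (LinearMap.proj i ∘ₗ f) (LinearMap.proj i ∘ₗ g), 0, 0, fun x => by
    simp [dotProduct]⟩

/-- The objective value at a KKT point with pattern `F` is a quadratic function of the data. -/
theorem exists_quadratic_value (hQ : Q.IsSymm) (F : Finset (Fin k)) :
    ∃ f : (Fin m → ℝ) × (Fin k → ℝ) → ℝ, IsQuadraticFunction f ∧ Continuous f ∧
      ∀ x z l, IsKKT Q D F x z l → objective Q x.1 z = f x := by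
  classical
  set P : Matrix (Fin k) (Fin k) ℝ := diagonal fun i => if i ∈ F then 1 else 0 with hP
  have hPapp : ∀ (w : Fin k → ℝ) i, (P *ᵥ w) i = if i ∈ F then w i else 0 := fun w i => by
    rw [hP, mulVec_diagonal]
    split_ifs <;> simp
  -- The equality part of the KKT conditions implies `M (z, l) = (q, P b) = Y x`, with `M`
  -- symmetric.
  set M : Matrix (Fin m ⊕ Fin k) (Fin m ⊕ Fin k) ℝ :=
    fromBlocks (-Q) (Dᵀ * P) (P * D) 0 with hM
  have hMsymm : M.IsSymm := by
    rw [IsSymm, hM, fromBlocks_transpose, transpose_neg, hQ.eq, transpose_mul, transpose_mul,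
      transpose_transpose, transpose_zero, hP, diagonal_transpose]
  let Y : (Fin m → ℝ) × (Fin k → ℝ) →ₗ[ℝ] (Fin m ⊕ Fin k → ℝ) :=
    { toFun := fun x => Sum.elim x.1 (P *ᵥ x.2)
      map_add' := fun x y => funext fun i => by cases i <;> simp [mulVec_add]
      map_smul' := fun c x => funext fun i => by cases i <;> simp [mulVec_smul] }
  obtain ⟨R, hR⟩ := exists_generalized_inverse M.mulVecLin
  refine ⟨fun x => Y x ⬝ᵥ ((1 / 2 : ℝ) • (R ∘ₗ Y)) x, isQuadraticFunction_dotProduct _ _, ?_, ?_⟩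
  · exact Y.continuous_of_finiteDimensional.dotProduct
      (LinearMap.continuous_of_finiteDimensional _)
  · intro x z l h
    have hu : M *ᵥ Sum.elim z l = Y x := by
      obtain ⟨-, h2, -, h4, h5⟩ := h
      have hPl : P *ᵥ l = l := funext fun i => by
        rw [hPapp]
        split_ifs with hi
        · rfl
        · exact (h4 i hi).symm
      have hPD : P *ᵥ (D *ᵥ z) = P *ᵥ x.2 := funext fun i => by
        rw [hPapp, hPapp]
        split_ifs with hi
        · exact h2 i hi
        · rfl
      rw [hM, fromBlocks_mulVec]
      simp only [Sum.elim_comp_inl, Sum.elim_comp_inr, zero_mulVec, add_zero, neg_mulVec,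
        ← mulVec_mulVec, hPl, hPD, ← h5]
      simp [Y]
    have hval : Y x ⬝ᵥ Sum.elim z l = x.1 ⬝ᵥ z + x.2 ⬝ᵥ l := by
      change Sum.elim x.1 (P *ᵥ x.2) ⬝ᵥ Sum.elim z l = _
      rw [sumElim_dotProduct_sumElim]
      congr 1
      refine Finset.sum_congr rfl fun i _ => ?_
      rw [hPapp]
      split_ifs with hi
      · rfl
      · rw [h.2.2.2.1 i hi, mul_zero, mul_zero]
    -- With `u = (z, l)`, symmetry gives `(M u) ⬝ R (M u) = u ⬝ M (R (M u)) = u ⬝ M u`. Hence the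
    -- value depends on `x` alone, even if `M` is singular.
    have hpinv : Y x ⬝ᵥ R (Y x) = Y x ⬝ᵥ Sum.elim z l := by
      have := hR (Sum.elim z l)
      simp only [mulVecLin_apply, hu] at this
      rw [← hu, dotProduct_comm, dotProduct_mulVec_comm hMsymm, hu, this, dotProduct_comm]
    rw [h.objective_eq, ← hval, ← hpinv]
    simp

/-- The feasible set depends lower semicontinuously on the right-hand side. -/
theorem eventually_exists_feasible_near {b : Fin k → ℝ} {z : Fin m → ℝ}
    (hz : z ∈ feasibleSet D b) {ε : ℝ} (hε : 0 < ε) :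
    ∀ᶠ b' in 𝓝 b, (feasibleSet D b').Nonempty → ∃ z' ∈ feasibleSet D b', ‖z' - z‖ ≤ ε := by
  -- These are the pairs `(b', s)` for which some point feasible for `b'` lies within sup-distance
  -- `s` of `z`.
  have hT : IsPolyhedron {p : (Fin k → ℝ) × ℝ | ∃ z' : Fin m → ℝ,
      0 ≤ D *ᵥ z' - p.1 ∧ ∀ j, -z j ≤ p.2 - z' j ∧ z j ≤ p.2 + z' j} := by
    refine isPolyhedron_setOf_exists (.inter (isPolyhedron_setOf_vec_le (E := (_ × _) × _)
      ⟨fun _ _ => ?_, fun _ _ => ?_⟩ 0) (isPolyhedron_setOf_forall fun j =>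
      .inter (isPolyhedron_setOf_le (E := (_ × _) × _) ⟨fun _ _ => ?_, fun _ _ => ?_⟩ _)
        (isPolyhedron_setOf_le (E := (_ × _) × _) ⟨fun _ _ => ?_, fun _ _ => ?_⟩ _)))
    · simp only [Prod.fst_add, Prod.snd_add, mulVec_add]
      abel
    · simp only [Prod.smul_fst, Prod.smul_snd, mulVec_smul, smul_sub]
    · simp only [Prod.fst_add, Prod.snd_add, Pi.add_apply]
      ring
    · simp only [Prod.smul_fst, Prod.smul_snd, Pi.smul_apply, smul_sub]
    · simp only [Prod.fst_add, Prod.snd_add, Pi.add_apply]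
      ring
    · simp only [Prod.smul_fst, Prod.smul_snd, Pi.smul_apply, smul_add]
  obtain ⟨N, a, β, hT⟩ := hT
  have hT' : ∀ b' s, (∃ z' ∈ feasibleSet D b', ∀ j, |z' j - z j| ≤ s) ↔
      ∀ i, β i ≤ a i (b', s) := fun b' s => by
    have := Set.ext_iff.1 hT (b', s)
    simp only [Set.mem_ofPred_eq] at this
    rw [← this]
    simp only [sub_nonneg, abs_le]
    refine exists_congr fun z' => and_congr Iff.rfl (forall_congr' fun j => ?_)
    constructor <;> rintro ⟨h1, h2⟩ <;> constructor <;> linarith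
  have hsplit : ∀ i b' s, a i (b', s) = a i (b', 0) + s * a i (0, 1) := fun i b' s => by
    have : ((b', s) : (Fin k → ℝ) × ℝ) = (b', 0) + s • (0, 1) := by simp
    rw [this, map_add, map_smul, smul_eq_mul]
  have hb : ∀ s, 0 ≤ s → ∀ i, β i ≤ a i (b, s) := fun s hs =>
    (hT' b s).1 ⟨z, hz, fun j => by simpa using hs⟩
  -- All `(b, s)` with `s ≥ 0` satisfy the inequalities, so no coefficient of `s` is negative.
  -- Inequalities not involving `s` hold for every feasible `b'`; those with a positive coefficient
  -- are strict at `(b, ε)`, hence hold nearby.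
  have hc : ∀ i, 0 ≤ a i (0, 1) := fun i => by
    by_contra! hneg
    have h0 := hb 0 le_rfl i
    have := hb ((a i (b, 0) - β i + 1) / (-a i (0, 1)))
      (div_nonneg (by linarith) (by linarith)) i
    rw [hsplit, div_mul_eq_mul_div, div_neg, mul_div_cancel_right₀ _ hneg.ne] at this
    linarith
  have hev : ∀ᶠ b' in 𝓝 b, ∀ i, (feasibleSet D b').Nonempty → β i ≤ a i (b', ε) := by
    rw [eventually_all]
    intro i
    rcases (hc i).eq_or_lt with hi | hi
    · refine Eventually.of_forall fun b' ⟨w, hw⟩ => ?_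
      have := (hT' b' ‖w - z‖).1 ⟨w, hw, fun j => norm_le_pi_norm (w - z) j⟩ i
      rw [hsplit, ← hi, mul_zero] at this ⊢
      exact this
    · have hcont : Continuous fun b' => a i (b', ε) :=
        (a i).continuous_of_finiteDimensional.comp (by fun_prop)
      have hlt : β i < a i (b, ε) := by
        have := hb 0 le_rfl i
        rw [hsplit]
        have := mul_pos hε hi
        linarith
      exact ((hcont.tendsto b).eventually_const_lt hlt).mono fun b' h _ => h.le
  filter_upwards [hev] with b' hb' hne
  obtain ⟨z', hz', h⟩ := (hT' b' ε).2 fun i => hb' i hne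
  exact ⟨z', hz', (pi_norm_le_iff_of_nonneg hε.le).2 h⟩

end KKT

/-! ### The domain, the solution set and the pieces of the value function. -/

section Domain

variable {m k : ℕ} {Q : Matrix (Fin m) (Fin m) ℝ} {D : Matrix (Fin k) (Fin m) ℝ}

theorem isPolyhedron_feasible :
    IsPolyhedron {x : (Fin m → ℝ) × (Fin k → ℝ) | (feasibleSet D x.2).Nonempty} := by
  have := isPolyhedron_setOf_exists (p := fun (x : (Fin m → ℝ) × (Fin k → ℝ)) z =>
    0 ≤ D *ᵥ z - x.2) (isPolyhedron_setOf_vec_le ⟨fun _ _ => by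
      simp only [Prod.fst_add, Prod.snd_add, mulVec_add]
      abel, fun _ _ => by
      simp only [Prod.smul_fst, Prod.smul_snd, mulVec_smul, smul_sub]⟩ 0)
  simp only [sub_nonneg] at this
  exact this

/-- Under copositivity, nonnegativity on the directions of the recession cone where the quadratic
form vanishes can be tested on finitely many of them. -/
theorem exists_test_directions (hQ : Q.IsSymm) (hcop : IsCopositiveOn Q (recessionCone D)) :
    ∃ (N : ℕ) (g : Fin N → Fin m → ℝ),
      (∀ j, g j ∈ recessionCone D ∧ g j ⬝ᵥ (Q *ᵥ g j) = 0) ∧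
      ∀ c : Fin m → ℝ, (∀ j, 0 ≤ c ⬝ᵥ g j) →
        ∀ v ∈ recessionCone D, v ⬝ᵥ (Q *ᵥ v) = 0 → 0 ≤ c ⬝ᵥ v := by
  have hgen : ∀ F : Finset (Fin k), ∃ (N : ℕ) (G : Matrix (Fin N) (Fin m) ℝ),
      (∀ j, G j ∈ {z | ∃ l, IsKKT Q D F 0 z l}) ∧
      ∀ v ∈ {z | ∃ l, IsKKT Q D F 0 z l}, ∃ l, 0 ≤ l ∧ v = Gᵀ *ᵥ l := fun F => by
    refine (isPolyhedron_isKKT_point 0).exists_generators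
      ⟨0, by simp, by simp, le_rfl, by simp, by simp⟩ ?_
    rintro z ⟨l, h1, h2, h3, h4, h5⟩ t ht
    refine ⟨t • l, ?_, fun i hi => ?_, smul_nonneg ht h3, fun i hi => ?_, ?_⟩
    · rw [mulVec_smul]
      exact smul_nonneg ht h1
    · rw [mulVec_smul, Pi.smul_apply, h2 i hi]
      simp
    · rw [Pi.smul_apply, h4 i hi, smul_zero]
    · rw [mulVec_smul, mulVec_smul, ← h5]
      simp
  choose N G hG1 hG2 using hgen
  obtain ⟨M, ⟨e⟩⟩ := Finite.exists_equiv_fin (Σ F, Fin (N F))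
  refine ⟨M, fun j => G (e.symm j).1 (e.symm j).2, fun j => ?_, fun c hc v hv hvQ => ?_⟩
  · obtain ⟨l, h⟩ := hG1 (e.symm j).1 (e.symm j).2
    refine ⟨h.1, ?_⟩
    have := h.dotProduct_eq
    rw [dotProduct_comm] at this
    simpa using this
  · have hsol : v ∈ qpSol Q D 0 := by
      refine ⟨hv, fun w hw => ?_⟩
      have := hcop w hw
      simp only [objective, Prod.fst_zero, zero_dotProduct, hvQ, Set.mem_ofPred_eq]
      linarith
    obtain ⟨F, l, hl⟩ := exists_isKKT_of_mem_qpSol hQ hsol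
    obtain ⟨t, ht, rfl⟩ := hG2 F v ⟨l, hl⟩
    rw [dotProduct_mulVec, vecMul_transpose]
    refine dotProduct_nonneg_of_nonneg (fun j => ?_) ht
    rw [mulVec, dotProduct_comm]
    have hc' : ∀ p : Σ F, Fin (N F), 0 ≤ c ⬝ᵥ G p.1 p.2 := fun p => by
      obtain ⟨i, rfl⟩ := e.symm.surjective p
      exact hc i
    exact hc' ⟨F, j⟩

/-- By symmetry of `Q` the condition says that the linear program with cost `Q *ᵥ v` has minimum at
least `-(q ⬝ᵥ v)`. Such a program falls under the existence theorem with zero quadratic part, and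
its KKT points are minimizers, so it suffices to ask for one KKT point satisfying the bound. -/
theorem isFiniteUnion_nonneg_direction (hQ : Q.IsSymm) (v : Fin m → ℝ) :
    IsFiniteUnionOfPolyhedra {x : (Fin m → ℝ) × (Fin k → ℝ) | (feasibleSet D x.2).Nonempty ∧
      ∀ z ∈ feasibleSet D x.2, 0 ≤ (x.1 + Q *ᵥ z) ⬝ᵥ v} := by
  have hexp : ∀ q z : Fin m → ℝ, (q + Q *ᵥ z) ⬝ᵥ v = q ⬝ᵥ v + (Q *ᵥ v) ⬝ᵥ z := fun q z => by
    rw [add_dotProduct, dotProduct_comm (Q *ᵥ z), dotProduct_mulVec_comm hQ v z,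
      dotProduct_comm z]
  simp only [hexp]
  have hpoly : ∀ F : Finset (Fin k), IsPolyhedron {x : (Fin m → ℝ) × (Fin k → ℝ) |
      ∃ z l, IsKKT 0 D F (Q *ᵥ v, x.2) z l ∧ 0 ≤ x.1 ⬝ᵥ v + (Q *ᵥ v) ⬝ᵥ z} := fun F => by
    let g : (((Fin m → ℝ) × (Fin k → ℝ)) × (Fin m → ℝ)) × (Fin k → ℝ) →ₗ[ℝ]
        (((Fin m → ℝ) × (Fin k → ℝ)) × (Fin m → ℝ)) × (Fin k → ℝ) :=
      { toFun := fun p => (((0, p.1.1.2), p.1.2), p.2)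
        map_add' := fun _ _ => by simp
        map_smul' := fun _ _ => by simp }
    have h1 := (isPolyhedron_isKKT (Q := 0) (D := D) (F := F)).preimage g (((Q *ᵥ v, 0), 0), 0)
    have h2 : IsPolyhedron {p : (((Fin m → ℝ) × (Fin k → ℝ)) × (Fin m → ℝ)) × (Fin k → ℝ) |
        0 ≤ p.1.1.1 ⬝ᵥ v + (Q *ᵥ v) ⬝ᵥ p.1.2} :=
      isPolyhedron_setOf_le ⟨fun _ _ => by
        simp only [Prod.fst_add, Prod.snd_add, add_dotProduct, dotProduct_add]
        ring, fun _ _ => by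
        simp only [Prod.smul_fst, Prod.smul_snd, smul_dotProduct, dotProduct_smul, smul_add]⟩ 0
    have h3 := h1.inter h2
    simp only [g, LinearMap.coe_mk, AddHom.coe_mk, Prod.mk_add_mk, zero_add, add_zero,
      Set.mem_ofPred_eq] at h3
    exact isPolyhedron_setOf_exists (p := fun (x : (Fin m → ℝ) × (Fin k → ℝ)) z =>
      ∃ l, IsKKT 0 D F (Q *ᵥ v, x.2) z l ∧
      0 ≤ x.1 ⬝ᵥ v + (Q *ᵥ v) ⬝ᵥ z) (isPolyhedron_setOf_exists
        (p := fun (y : ((Fin m → ℝ) × (Fin k → ℝ)) × (Fin m → ℝ)) l =>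
          IsKKT 0 D F (Q *ᵥ v, y.1.2) y.2 l ∧ 0 ≤ y.1.1 ⬝ᵥ v + (Q *ᵥ v) ⬝ᵥ y.2) h3)
  convert IsFiniteUnionOfPolyhedra.of_finite hpoly using 1
  ext x
  simp only [Set.mem_ofPred_eq, Set.mem_iUnion]
  constructor
  · rintro ⟨hne, h⟩
    have h0 : (0 : Matrix (Fin m) (Fin m) ℝ).IsSymm := transpose_zero
    obtain ⟨z, hz⟩ := qpSol_nonempty (Q := 0) (D := D) h0 (fun w _ => by simp)
      (x := (Q *ᵥ v, x.2)) (mem_qpDom_iff.2 ⟨hne, -(x.1 ⬝ᵥ v), fun z hz => by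
        have := h z hz
        simp only [objective, zero_mulVec, dotProduct_zero]
        linarith⟩)
    obtain ⟨F, l, hl⟩ := exists_isKKT_of_mem_qpSol h0 hz
    exact ⟨F, z, l, hl, h z hz.1⟩
  · rintro ⟨F, z, l, hl, h⟩
    refine ⟨⟨z, hl.1⟩, fun w hw => ?_⟩
    have := hl.dotProduct_le hw
    simp only [zero_mulVec, add_zero] at this
    linarith

theorem isFiniteUnion_qpDom (hQ : Q.IsSymm) (hcop : IsCopositiveOn Q (recessionCone D)) :
    IsFiniteUnionOfPolyhedra (qpDom Q D) := by
  obtain ⟨N, g, hg, htest⟩ := exists_test_directions hQ hcop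
  convert (isPolyhedron_feasible (D := D)).isFiniteUnion.inter (IsFiniteUnionOfPolyhedra.iInter
    fun j => isFiniteUnion_nonneg_direction (D := D) hQ (g j)) using 1
  ext x
  simp only [Set.mem_inter_iff, Set.mem_ofPred_eq, Set.mem_iInter]
  constructor
  · intro hx
    exact ⟨(mem_qpDom_iff.1 hx).1, fun j => ⟨(mem_qpDom_iff.1 hx).1, fun z hz =>
      dotProduct_nonneg_of_mem_qpDom hQ hx (hg j).1 (hg j).2 hz⟩⟩
  · rintro ⟨hne, h⟩
    obtain ⟨z, hz⟩ := qpSol_nonempty_of_forall hQ hcop (q := x.1) hne fun v hv hvQ z hz =>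
      htest _ (fun j => (h j).2 z hz) v hv hvQ
    exact mem_qpDom_of_mem_qpSol hz

theorem qpVal_le {x : (Fin m → ℝ) × (Fin k → ℝ)} (hx : x ∈ qpDom Q D) {z : Fin m → ℝ}
    (hz : z ∈ feasibleSet D x.2) : qpVal Q D x ≤ objective Q x.1 z := by
  rw [qpVal, ← EReal.coe_le_coe_iff, EReal.coe_toReal hx.2.ne hx.1.ne']
  exact iInf₂_le z hz

/-- For fixed data all KKT points of one pattern share the same objective value, so they are all
optimal or none is. -/
theorem isFiniteUnion_qpSol (hQ : Q.IsSymm) {x : (Fin m → ℝ) × (Fin k → ℝ)}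
    (hx : x ∈ qpDom Q D) : IsFiniteUnionOfPolyhedra (qpSol Q D x) := by
  choose f _ _ hval using exists_quadratic_value (D := D) hQ
  have hpoly : ∀ F : Finset (Fin k),
      IsPolyhedron ({_z | f F x = qpVal Q D x} ∩ {z | ∃ l, IsKKT Q D F x z l}) := fun F =>
    (isPolyhedron_const _).inter (isPolyhedron_isKKT_point x)
  convert IsFiniteUnionOfPolyhedra.of_finite hpoly using 1
  ext z
  simp only [Set.mem_iUnion, Set.mem_inter_iff, Set.mem_ofPred_eq]
  constructor
  · intro hz
    obtain ⟨F, l, hl⟩ := exists_isKKT_of_mem_qpSol hQ hz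
    exact ⟨F, by rw [← hval F x z l hl, qpVal_eq_of_mem_qpSol hz], l, hl⟩
  · rintro ⟨F, hF, l, hl⟩
    refine ⟨hl.1, fun w hw => ?_⟩
    rw [Set.mem_ofPred_eq, hval F x z l hl, hF]
    exact qpVal_le hx hw

/-- The optimal value as the minimum of finitely many quadratic functions, each of them valid on a
polyhedron. -/
theorem exists_quadratic_pieces (hQ : Q.IsSymm) (hcop : IsCopositiveOn Q (recessionCone D)) :
    ∃ (N : ℕ) (S : Fin N → Set ((Fin m → ℝ) × (Fin k → ℝ)))
      (f : Fin N → (Fin m → ℝ) × (Fin k → ℝ) → ℝ),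
      (∀ F, IsPolyhedron (S F)) ∧ (∀ F, IsQuadraticFunction (f F)) ∧ (∀ F, Continuous (f F)) ∧
      qpDom Q D = ⋃ F, S F ∧
      ∀ x ∈ qpDom Q D, IsLeast {r : ℝ | ∃ F, x ∈ S F ∧ r = f F x} (qpVal Q D x) := by
  choose f hquad hcont hval using exists_quadratic_value (D := D) hQ
  obtain ⟨M, P, hP, hdom⟩ := isFiniteUnion_qpDom hQ hcop
  obtain ⟨N, ⟨e⟩⟩ := Finite.exists_equiv_fin (Finset (Fin k) × Fin M)
  have hpiece : ∀ x ∈ qpDom Q D, ∃ i, x ∈ P (e.symm i).2 ∩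
      {x | ∃ z l, IsKKT Q D (e.symm i).1 x z l} ∧ qpVal Q D x = f (e.symm i).1 x := by
    intro x hx
    obtain ⟨z, hz⟩ := qpSol_nonempty hQ hcop hx
    obtain ⟨F, l, hl⟩ := exists_isKKT_of_mem_qpSol hQ hz
    obtain ⟨j, hj⟩ := Set.mem_iUnion.1 (hdom ▸ hx)
    refine ⟨e (F, j), ?_⟩
    rw [e.symm_apply_apply, qpVal_eq_of_mem_qpSol hz]
    exact ⟨⟨hj, z, l, hl⟩, hval F x z l hl⟩
  -- Intersecting with the polyhedra covering the domain is needed: a KKT point may exist while the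
  -- objective is unbounded below.
  refine ⟨N, fun i => P (e.symm i).2 ∩ {x | ∃ z l, IsKKT Q D (e.symm i).1 x z l},
    fun i => f (e.symm i).1, fun i => (hP _).inter isPolyhedron_exists_isKKT, fun i => hquad _,
    fun i => hcont _, ?_, fun x hx => ⟨hpiece x hx, ?_⟩⟩
  · refine Set.Subset.antisymm (fun x hx => ?_) (Set.iUnion_subset fun i x hx => ?_)
    · obtain ⟨i, hi, -⟩ := hpiece x hx
      exact Set.mem_iUnion.2 ⟨i, hi⟩
    · rw [hdom]
      exact Set.mem_iUnion.2 ⟨_, hx.1⟩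
  · rintro r ⟨i, ⟨-, z, l, hl⟩, rfl⟩
    exact (qpVal_le hx hl.1).trans_eq (hval _ x z l hl)

/-- Lower semicontinuity: near `x` only pieces containing `x` occur, since pieces are closed, and
their continuous functions are at least the optimal value at `x`. Upper semicontinuity: an optimal
solution at `x` is approximated by feasible points for nearby data. -/
theorem continuousOn_qpVal (hQ : Q.IsSymm) (hcop : IsCopositiveOn Q (recessionCone D)) :
    ContinuousOn (qpVal Q D) (qpDom Q D) := by
  obtain ⟨N, S, f, hS, -, hcont, -, hleast⟩ := exists_quadratic_pieces hQ hcop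
  intro x hx
  refine tendsto_order.2 ⟨fun a ha => ?_, fun a ha => ?_⟩
  · have hev : ∀ᶠ y in 𝓝 x, ∀ i, y ∈ S i → a < f i y := by
      rw [eventually_all]
      intro i
      by_cases hi : x ∈ S i
      · have := ((hcont i).tendsto x).eventually_const_lt
          (ha.trans_le ((hleast x hx).2 ⟨i, hi, rfl⟩))
        exact this.mono fun y hy _ => hy
      · exact ((hS i).isClosed.isOpen_compl.eventually_mem hi).mono fun y hy h => (hy h).elim
    filter_upwards [hev.filter_mono nhdsWithin_le_nhds, self_mem_nhdsWithin] with y hy hyd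
    obtain ⟨i, hi, h⟩ := (hleast y hyd).1
    rw [h]
    exact hy i hi
  · obtain ⟨z, hz⟩ := qpSol_nonempty hQ hcop hx
    rw [qpVal_eq_of_mem_qpSol hz] at ha
    obtain ⟨δ, hδ, hball⟩ := Metric.eventually_nhds_iff_ball.1
      (((continuous_objective (Q := Q)).tendsto (x.1, z)).eventually_lt_const ha)
    have h1 : ∀ᶠ y : (Fin m → ℝ) × (Fin k → ℝ) in 𝓝 x, dist y.1 x.1 < δ :=
      (continuous_fst.tendsto x).eventually (Metric.ball_mem_nhds _ hδ)
    have h2 := (continuous_snd.tendsto x).eventually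
      (eventually_exists_feasible_near hz.1 (half_pos hδ))
    filter_upwards [h1.filter_mono nhdsWithin_le_nhds, h2.filter_mono nhdsWithin_le_nhds,
      self_mem_nhdsWithin] with y hy1 hy2 hyd
    obtain ⟨w, hw, hwz⟩ := hy2 (mem_qpDom_iff.1 hyd).1
    refine (qpVal_le hyd hw).trans_lt (hball (y.1, w) ?_)
    rw [Metric.mem_ball, Prod.dist_eq, max_lt_iff, dist_eq_norm w z]
    exact ⟨hy1, hwz.trans_lt (half_lt_self hδ)⟩

theorem isPiecewiseQuadraticOn_qpVal (hQ : Q.IsSymm)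
    (hcop : IsCopositiveOn Q (recessionCone D)) :
    IsPiecewiseQuadraticOn (qpVal Q D) (qpDom Q D) := by
  refine ⟨continuousOn_qpVal hQ hcop, ?_⟩
  obtain ⟨N, S, f, -, hquad, -, -, hleast⟩ := exists_quadratic_pieces hQ hcop
  -- The extra zero function only ensures that the family is nonempty, without having to show `0 <
  -- N`.
  refine ⟨N + 1, Fin.cons 0 f, N.succ_pos, Fin.cases ⟨0, 0, 0, fun _ => by simp⟩ hquad,
    fun x hx => ?_⟩
  obtain ⟨i, -, h⟩ := (hleast x hx).1
  exact ⟨i.succ, h⟩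

end Domain

end CopositiveQP

theorem mainTheorem3 (m k : ℕ) (Q : Matrix (Fin m) (Fin m) ℝ) (D : Matrix (Fin k) (Fin m) ℝ)
    (hQsymm : Q.IsSymm) (hQ : IsCopositiveOn Q (recessionCone D)) :
    -- (a)
    ContinuousOn (qpVal Q D) (qpDom Q D) ∧
    -- (b)
    (IsFiniteUnionOfPolyhedra (qpDom Q D) ∧ IsClosed (qpDom Q D)) ∧
    -- (c)
    ((∃ (N : ℕ) (S : Fin N → Set ((Fin m → ℝ) × (Fin k → ℝ)))
        (f : Fin N → (Fin m → ℝ) × (Fin k → ℝ) → ℝ),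
        (∀ F, IsPolyhedron (S F)) ∧ (∀ F, IsQuadraticFunction (f F)) ∧
        qpDom Q D = ⋃ F, S F ∧
        ∀ x ∈ qpDom Q D, IsLeast {r : ℝ | ∃ F, x ∈ S F ∧ r = f F x} (qpVal Q D x)) ∧
      IsPiecewiseQuadraticOn (qpVal Q D) (qpDom Q D)) ∧
    -- (d)
    (∀ x ∈ qpDom Q D, (qpSol Q D x).Nonempty ∧ IsFiniteUnionOfPolyhedra (qpSol Q D x)) := by
  have hunion := isFiniteUnion_qpDom hQsymm hQ
  obtain ⟨N, S, f, hS, hf, -, hdom, hleast⟩ := exists_quadratic_pieces hQsymm hQ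
  exact ⟨continuousOn_qpVal hQsymm hQ, ⟨hunion, hunion.isClosed⟩,
    ⟨⟨N, S, f, hS, hf, hdom, hleast⟩, isPiecewiseQuadraticOn_qpVal hQsymm hQ⟩,
    fun x hx => ⟨qpSol_nonempty hQsymm hQ hx, isFiniteUnion_qpSol hQsymm hx⟩⟩
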